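/- A problem is a partial multi-valued function $f:\subseteq\mathbb{N}^{\mathbb{N}}\rightrightarrows\mathbb{N}^{\mathbb{N}}$, with $\operatorname{dom}(f)=\{p : f(p)\neq\emptyset\}$. Let $(\Phi_e)_{e\in\mathbb{N}}$ be a standard computable enumeration of the partial computable functionals from $\mathbb{N}^{\mathbb{N}}$ to $\mathbb{N}^{\mathbb{N}}$, and write $\Phi_i(p,q)$ for $\Phi_i(\langle p,q\rangle)$, where $\langle p,q\rangle$ is the join of $p$ and $q$. For problems $f,g$, write $f\le_{\mathrm W} g$ if there are $e,i\in\mathbb{N}$ such that for every $p\in\operatorname{dom}(f)$, $\Phi_e(p)$ is defined and lies in $\operatorname{dom}(g)$, and for every $q\in g(\Phi_e(p))$, $\Phi_i(p,q)$ is defined and lies in $f(p)$; write $f\equiv_{\mathrm W} g$ if $f\le_{\mathrm W} g$ and $g\le_{\mathrm W} f$. The totalizing jump of a problem $f$ is the problem $\mathsf{tJ}(f)$ which, for $e,i\in\mathbb{N}$ and $p\in\mathbb{N}^{\mathbb{N}}$, is given by \[ \mathsf{tJ}(f)(e,i,p)=\begin{cases}\{\Phi_i(p,q) : q\in f(\Phi_e(p))\}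 & \text{if } \Phi_e(p) \text{ is defined and lies in } \operatorname{dom}(f), \text{ and } \Phi_i(p,q) \text{ is defined for all } q\in f(\Phi_e(p)),\\ \mathbb{N}^{\mathbb{N}} & \text{otherwise,}\end{cases} \] where the triple $(e,i,p)$ is identified with the sequence $e,i,p(0),p(1),\dots$. Let $\mathsf{TC}_{\mathbb{N}}$ be the total continuation of choice on $\mathbb{N}$: given $p\in\mathbb{N}^{\mathbb{N}}$, find $n\in\mathbb{N}$ with $n+1\notin\operatorname{ran}(p)$ if there is such an $n$; otherwise, every $n\in\mathbb{N}$ is a solution. Here a solution $n$ is represented by any $q\in\mathbb{N}^{\mathbb{N}}$ with $q(0)=n$. Then there is no problem $f$ such that $\mathsf{TC}_{\mathbb{N}}\equiv_{\mathrm W}\mathsf{tJ}(f)$. -/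

import Mathlib

namespace Weihrauch

/-- Baire space `ℕ^ℕ`. -/
abbrev Baire : Type := ℕ → ℕ

/-- The prefix `p[k]` of length `k` of `p`. -/
def initSeg (p : Baire) (k : ℕ) : List ℕ := (List.range k).map p

/-- The value `Φ_e(p)(n)` (possibly undefined).  The `e`-th program is run, in a dovetailed search
over pairs (prefix length `k`, number of steps `t`), on the inputs `(p[k], n)`; the value is the
output of the first such computation that is found to halt. -/
def functionalValue (e : ℕ) (p : Baire) (n : ℕ) : Part ℕ :=
  Nat.rfindOpt fun s =>
    Nat.Partrec.Code.evaln s.unpair.2 (Denumerable.ofNat Nat.Partrec.Code e)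
      (Encodable.encode (initSeg p s.unpair.1, n))

/-- The enumeration `(Φ_e)` of the partial computable functionals from Baire space to itself:
`Φ_e(p)` is defined iff `Φ_e(p)(n)` is defined for every `n`. -/
def functional (e : ℕ) (p : Baire) : Part Baire :=
  ⟨∀ n, (functionalValue e p n).Dom, fun h n => (functionalValue e p n).get (h n)⟩

/-- The join `⟨p, q⟩`, with `⟨p, q⟩(2n) = p(n)` and `⟨p, q⟩(2n+1) = q(n)`. -/
def join (p q : Baire) : Baire := fun n => if n % 2 = 0 then p (n / 2) else q (n / 2)

/-- The enumeration of the partial computable functionals `ℕ^ℕ × ℕ^ℕ → ℕ^ℕ`. -/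
def functional₂ (i : ℕ) (p q : Baire) : Part Baire := functional i (join p q)

/-- A partial multi-valued function from Baire space to itself, given by its sets of values. -/
abbrev Problem : Type := Baire → Set Baire

/-- The domain of a partial multi-valued function: the points that have at least one value. -/
def dom (f : Problem) : Set Baire := {p | (f p).Nonempty}

/-- Weihrauch reducibility `f ≤_W g`; `Φ_e` is the forward and `Φ_i` the backward functional. -/
def Reducible (f g : Problem) : Prop :=
  ∃ e i : ℕ, ∀ p ∈ dom f, ∃ r ∈ functional e p, r ∈ dom g ∧
    ∀ q ∈ g r, ∃ y ∈ functional₂ i p q, y ∈ f p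

/-- Weihrauch equivalence `f ≡_W g`. -/
def Equivalent (f g : Problem) : Prop := Reducible f g ∧ Reducible g f

open Classical in
/-- The total continuation of a problem on Baire space. -/
noncomputable def totalization (f : Problem) : Problem :=
  fun p => if p ∈ dom f then f p else Set.univ

/-- Choice on `ℕ`: given `p` such that `n + 1 ∉ ran(p)` for some `n`, find such an `n`.
A natural number `n` is represented by any `q` with `q(0) = n`. -/
def choiceNat : Problem := fun p => {q | q 0 + 1 ∉ Set.range p}

/-- The total continuation `TC_ℕ` of choice on `ℕ`. -/
noncomputable def totalChoiceNat : Problem := totalization choiceNat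

open Classical in
/-- The value `tJ(f)(e, i, p)` of the totalizing jump of `f`. -/
noncomputable def totJumpAt (f : Problem) (e i : ℕ) (p : Baire) : Set Baire :=
  if ∃ r ∈ functional e p, r ∈ dom f ∧ ∀ q ∈ f r, (functional₂ i p q).Dom then
    {y | ∃ r ∈ functional e p, ∃ q ∈ f r, y ∈ functional₂ i p q}
  else Set.univ

/-- The totalizing jump `tJ(f)`, as a problem on Baire space: the input `(e, i, p)` is represented
by the sequence `e, i, p(0), p(1), …`. -/
noncomputable def totJump (f : Problem) : Problem :=
  fun x => totJumpAt f (x 0) (x 1) fun n => x (n + 2)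

end Weihrauch

namespace Weihrauch

open Encodable Denumerable
open Nat.Partrec (Code)

/-! ### Bounded search -/

/-! If `f` has no instance, `totJump f` accepts every answer, so a reduction of `totalChoiceNat` to
it would solve `totalChoiceNat` continuously; a finite prefix of the input cannot ensure a correct
answer (`not_totalChoiceNat_reducible_totJump`).

If `f` has an instance `p`, suppose `totJump f` reduces to `totalChoiceNat` by Φ_a and Φ_b. The
recursion theorem (`exists_index`) gives an input x = (e, i, p), with Φ_e the identity, for which
Φ_i(p, q) is one sequence z whatever q is, so z is the only solution of x. Here z(0) differs from
Φ_b(x, n)(0) for some n, and z(n+1) differs from Φ_b(x, n)(n+1) unless n+1 is seen in the range of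
Φ_a(x). If that range omits some n+1, then n is a correct answer and z(n+1) refutes Φ_b; if it omits
none, every n is correct and z(0) refutes Φ_b (`not_totJump_reducible_totalChoiceNat`). -/

/-- The first value of `h` found at an argument below `t`. -/
def firstHit (h : ℕ → Option ℕ) (t : ℕ) : Option ℕ :=
  Nat.rec none (fun k r => r <|> h k) t

theorem firstHit_succ (h : ℕ → Option ℕ) (t : ℕ) :
    firstHit h (t + 1) = (firstHit h t <|> h t) := rfl

theorem primrec_firstHit {α : Type*} [Primcodable α] {h : α → ℕ → Option ℕ} {t : α → ℕ}
    (hh : Primrec₂ h) (ht : Primrec t) : Primrec fun a => firstHit (h a) (t a) :=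
  Primrec.nat_rec' ht (Primrec.const none)
    (Primrec.option_orElse.comp (Primrec.snd.comp Primrec.snd)
      (hh.comp Primrec.fst (Primrec.fst.comp Primrec.snd))).to₂

theorem firstHit_congr {h g : ℕ → Option ℕ} {t : ℕ} (H : ∀ k < t, h k = g k) :
    firstHit h t = firstHit g t := by
  induction t with
  | zero => rfl
  | succ t ih =>
    rw [firstHit_succ, firstHit_succ, ih fun k hk => H k (by omega), H t (by omega)]

theorem exists_of_firstHit_eq_some {h : ℕ → Option ℕ} {t v : ℕ} (H : firstHit h t = some v) :
    ∃ k < t, h k = some v := by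
  induction t with
  | zero => simp [firstHit] at H
  | succ t ih =>
    rw [firstHit_succ] at H
    cases hf : firstHit h t with
    | none => rw [hf] at H; exact ⟨t, by omega, by simpa using H⟩
    | some w =>
      rw [hf] at H
      obtain rfl : w = v := by simpa using H
      obtain ⟨k, hk, hv⟩ := ih hf
      exact ⟨k, by omega, hv⟩

theorem firstHit_mono {h : ℕ → Option ℕ} {s t v : ℕ} (hst : s ≤ t) (H : firstHit h s = some v) :
    firstHit h t = some v := by
  induction t, hst using Nat.le_induction with
  | base => exact H
  | succ t _ ih => rw [firstHit_succ, ih]; rfl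

theorem exists_firstHit_eq_some {h : ℕ → Option ℕ} {k t v : ℕ} (hk : k < t) (H : h k = some v) :
    ∃ w, firstHit h t = some w := by
  cases hf : firstHit h k with
  | some w => exact ⟨w, firstHit_mono hk.le hf⟩
  | none => exact ⟨v, firstHit_mono hk (by rw [firstHit_succ, hf, H]; rfl)⟩

/-- Turns an unbounded search into stages that are monotone and primitive recursive. -/
theorem mem_rfindOpt_iff_exists_firstHit {h : ℕ → Option ℕ} {v : ℕ} :
    v ∈ Nat.rfindOpt h ↔ ∃ t, firstHit h t = some v := by
  have key : ∀ {v}, v ∈ Nat.rfindOpt h → ∃ t, firstHit h t = some v := by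
    intro v hv
    obtain ⟨k, hk, hv⟩ := Part.mem_bind_iff.1 hv
    have hn : firstHit h k = none := by
      by_contra hne
      obtain ⟨w, hw⟩ := Option.ne_none_iff_exists'.1 hne
      obtain ⟨j, hj, hjw⟩ := exists_of_firstHit_eq_some hw
      have := Nat.rfind_min hk hj
      simp [hjw] at this
    refine ⟨k + 1, ?_⟩
    rw [firstHit_succ, hn]
    simpa using hv
  refine ⟨key, fun ⟨t, ht⟩ => ?_⟩
  obtain ⟨k, _, hk⟩ := exists_of_firstHit_eq_some ht
  have hd : (Nat.rfindOpt h).Dom := Nat.rfindOpt_dom.2 ⟨k, v, hk⟩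
  obtain ⟨s, hs⟩ := key (Part.get_mem hd)
  have h1 := firstHit_mono (le_max_left s t) hs
  have h2 := firstHit_mono (le_max_right s t) ht
  rw [h1] at h2
  rw [← Option.some.inj h2]
  exact Part.get_mem hd

/-! ### Prefixes -/

@[simp] theorem length_initSeg (p : Baire) (k : ℕ) : (initSeg p k).length = k := by
  simp [initSeg]

theorem take_initSeg (p : Baire) {j k : ℕ} (h : j ≤ k) :
    (initSeg p k).take j = initSeg p j := by
  simp [initSeg, ← List.map_take, List.take_range, h]

theorem getElem?_initSeg (p : Baire) {j k : ℕ} (h : j < k) :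
    (initSeg p k)[j]? = some (p j) := by
  simp [initSeg, h]

theorem initSeg_congr {p q : Baire} {k : ℕ} (h : ∀ j < k, p j = q j) :
    initSeg p k = initSeg q k := by
  simp only [initSeg, List.map_inj_left, List.mem_range]
  exact h

/-! ### Approximations of functionals and the recursion theorem -/

/-- The value of the `e`-th functional at `n`, as far as it is determined by the prefix `σ` of the
argument within `σ.length` rounds of the search. -/
def approx (e : ℕ) (σ : List ℕ) (n : ℕ) : Option ℕ :=
  firstHit (fun s => Code.evaln s.unpair.2 (ofNat Code e)
    (encode (σ.take s.unpair.1, n))) σ.length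

theorem primrec_approx {α : Type*} [Primcodable α] {e n : α → ℕ} {σ : α → List ℕ}
    (he : Primrec e) (hσ : Primrec σ) (hn : Primrec n) :
    Primrec fun a => approx (e a) (σ a) (n a) := by
  refine primrec_firstHit ?_ (Primrec.list_length.comp hσ)
  have hs : Primrec fun x : α × ℕ => x.2.unpair := Primrec.unpair.comp Primrec.snd
  exact Code.primrec_evaln.comp <| Primrec.pair
    (Primrec.pair (Primrec.snd.comp hs) ((Primrec.ofNat Code).comp (he.comp Primrec.fst)))
    (Primrec.encode.comp <| Primrec.pair
      (Primrec.list_take.comp (Primrec.fst.comp hs) (hσ.comp Primrec.fst)) (hn.comp Primrec.fst))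

/-- Continuity: round `k` of the search reads a prefix of length `k.unpair.1 ≤ k`, so `s` rounds see
only `initSeg p s`. -/
theorem mem_functionalValue_iff {e : ℕ} {p : Baire} {n v : ℕ} :
    v ∈ functionalValue e p n ↔ ∃ s, approx e (initSeg p s) n = some v := by
  rw [functionalValue, mem_rfindOpt_iff_exists_firstHit]
  refine exists_congr fun s => ?_
  rw [approx, length_initSeg]
  rw [firstHit_congr fun k hk => ?_]
  rw [take_initSeg p ((Nat.unpair_left_le k).trans hk.le)]

theorem approx_mono {e : ℕ} {p : Baire} {n v s t : ℕ} (hst : s ≤ t)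
    (h : approx e (initSeg p s) n = some v) : approx e (initSeg p t) n = some v := by
  have key : ∀ s, approx e (initSeg p s) n = firstHit (fun k => Code.evaln k.unpair.2
      (ofNat Code e) (encode (initSeg p k.unpair.1, n))) s := by
    intro s
    rw [approx, length_initSeg]
    refine firstHit_congr fun k hk => ?_
    rw [take_initSeg p ((Nat.unpair_left_le k).trans hk.le)]
  rw [key] at h ⊢
  exact firstHit_mono hst h

/-- A functional may be defined by a primitive recursive test on the prefixes of its argument that
refers to its own index: the value is that of the first successful test. -/
theorem exists_index {T : ℕ → List ℕ → ℕ → Option ℕ}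
    (hT : Primrec fun a : ℕ × List ℕ × ℕ => T a.1 a.2.1 a.2.2) :
    ∃ i, ∀ p n, functionalValue i p n = Nat.rfindOpt fun s => T i (initSeg p s) n := by
  -- On a prefix, the program tries all shorter prefixes too, so its answers on different prefixes
  -- of `p` agree and the dovetailing order is immaterial. The `+ 1` includes the whole prefix.
  let F : Code → ℕ → Option ℕ := fun c N =>
    firstHit (fun s => T (encode c) ((ofNat (List ℕ × ℕ) N).1.take s) (ofNat (List ℕ × ℕ) N).2)
      ((ofNat (List ℕ × ℕ) N).1.length + 1)
  have hN : Primrec fun a : Code × ℕ => ofNat (List ℕ × ℕ) a.2 :=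
    (Primrec.ofNat _).comp Primrec.snd
  have hF : Primrec fun a : Code × ℕ => F a.1 a.2 := by
    refine primrec_firstHit ?_ (Primrec.succ.comp (Primrec.list_length.comp (Primrec.fst.comp hN)))
    exact hT.comp <| Primrec.pair (Primrec.encode.comp (Primrec.fst.comp Primrec.fst)) <|
      Primrec.pair (Primrec.list_take.comp Primrec.snd
        (Primrec.fst.comp (hN.comp Primrec.fst))) (Primrec.snd.comp (hN.comp Primrec.fst))
  have hFp : Partrec₂ fun (c : Code) (N : ℕ) => (F c N : Part ℕ) :=
    Computable.ofOption hF.to_comp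
  obtain ⟨c, hc⟩ := Code.fixed_point₂ hFp
  refine ⟨encode c, fun p n => ?_⟩
  have hval : ∀ k, Code.eval c (encode (initSeg p k, n)) =
      (firstHit (fun s => T (encode c) (initSeg p s) n) (k + 1) : Part ℕ) := by
    intro k
    rw [hc]
    simp only [F, ofNat_encode, length_initSeg]
    rw [firstHit_congr fun j hj => ?_]
    rw [take_initSeg p (by omega)]
  have hsub : ∀ v ∈ functionalValue (encode c) p n,
      v ∈ Nat.rfindOpt fun s => T (encode c) (initSeg p s) n := by
    intro v hv
    obtain ⟨s, hs⟩ := Nat.rfindOpt_spec hv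
    rw [ofNat_encode] at hs
    have hs' := Code.evaln_sound hs
    rw [hval, Part.mem_coe] at hs'
    exact mem_rfindOpt_iff_exists_firstHit.2 ⟨_, hs'⟩
  refine Part.ext' ⟨fun h => ?_, fun h => ?_⟩ fun h₁ h₂ => ?_
  · exact Part.dom_iff_mem.2 ⟨_, hsub _ (Part.get_mem h)⟩
  · obtain ⟨k, v, hk⟩ := Nat.rfindOpt_dom.1 h
    obtain ⟨w, hw⟩ := exists_firstHit_eq_some (h := fun s => T (encode c) (initSeg p s) n)
      (Nat.lt_succ_self k) hk
    have hev : w ∈ Code.eval c (encode (initSeg p k, n)) := by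
      rw [hval, Part.mem_coe]; exact hw
    obtain ⟨t, ht⟩ := Code.evaln_complete.1 hev
    refine Nat.rfindOpt_dom.2 ⟨Nat.pair k t, w, ?_⟩
    simpa using ht
  · exact Part.mem_unique (hsub _ (Part.get_mem h₁)) (Part.get_mem h₂)

theorem mem_functional_iff {e : ℕ} {p y : Baire} :
    y ∈ functional e p ↔ ∀ n, y n ∈ functionalValue e p n := by
  constructor
  · rintro ⟨h, rfl⟩ n
    exact Part.get_mem (h n)
  · intro h
    refine ⟨fun n => Part.dom_iff_mem.2 ⟨_, h n⟩, funext fun n => ?_⟩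
    exact Part.mem_unique (Part.get_mem (Part.dom_iff_mem.2 ⟨_, h n⟩)) (h n)

theorem exists_index_id : ∃ e, ∀ p, functional e p = Part.some p := by
  obtain ⟨e, he⟩ := exists_index (T := fun _ σ n => σ[n]?)
    (Primrec.list_getElem?.comp (Primrec.fst.comp Primrec.snd) (Primrec.snd.comp Primrec.snd))
  have hv : ∀ p n, p n ∈ functionalValue e p n := by
    intro p n
    have hd : (functionalValue e p n).Dom := by
      rw [he]
      exact Nat.rfindOpt_dom.2 ⟨n + 1, p n, getElem?_initSeg p (Nat.lt_succ_self n)⟩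
    obtain ⟨v, hv⟩ := Part.dom_iff_mem.1 hd
    have hv' := hv
    rw [he] at hv'
    obtain ⟨s, hs⟩ := Nat.rfindOpt_spec hv'
    simp only [Option.mem_def, initSeg, List.getElem?_map, Option.map_eq_some_iff,
      List.getElem?_eq_some_iff] at hs
    obtain ⟨m, ⟨_, hm⟩, rfl⟩ := hs
    rw [List.getElem_range] at hm
    rw [← hm] at hv
    exact hv
  exact ⟨e, fun p => Part.eq_some_iff.2 (mem_functional_iff.2 (hv p))⟩

/-- The entries of `σ` at even positions. -/
def evens (σ : List ℕ) : List ℕ := (List.range ((σ.length + 1) / 2)).map fun j => σ.getD (2 * j) 0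

theorem primrec_evens : Primrec evens :=
  Primrec.list_map (Primrec.list_range.comp <| Primrec.nat_div.comp
      (Primrec.succ.comp Primrec.list_length) (Primrec.const 2))
    ((Primrec.list_getD 0).comp Primrec.fst
      (Primrec.nat_mul.comp (Primrec.const 2) Primrec.snd)).to₂

theorem evens_initSeg_join (p q : Baire) (s : ℕ) :
    evens (initSeg (join p q) s) = initSeg p ((s + 1) / 2) := by
  rw [evens, length_initSeg]
  simp only [initSeg, List.map_inj_left, List.mem_range]
  intro j hj
  have hj' : 2 * j < s := by omega
  simp [List.getD_eq_getElem?_getD, hj', join]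

/-- Discarding the odd positions makes the value independent of `q`. -/
theorem exists_index_join {T : ℕ → List ℕ → ℕ → Option ℕ}
    (hT : Primrec fun a : ℕ × List ℕ × ℕ => T a.1 a.2.1 a.2.2) :
    ∃ i, ∀ p q n, functionalValue i (join p q) n =
      Nat.rfindOpt fun s => T i (initSeg p ((s + 1) / 2)) n := by
  obtain ⟨i, hi⟩ := exists_index (T := fun i σ n => T i (evens σ) n)
    (hT.comp <| Primrec.pair Primrec.fst <| Primrec.pair
      (primrec_evens.comp (Primrec.fst.comp Primrec.snd)) (Primrec.snd.comp Primrec.snd))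
  exact ⟨i, fun p q n => by rw [hi]; simp only [evens_initSeg_join]⟩

/-! ### Problems without instances -/

/-- The standard representative of the natural number `n` as a point of Baire space. -/
def point (n : ℕ) : Baire := fun j => if j = 0 then n else 0

theorem join_congr {p p' q : Baire} {k : ℕ} (h : ∀ j < k, p j = p' j) :
    ∀ j < k, join p q j = join p' q j := by
  intro j hj
  simp only [join, h (j / 2) (by omega)]

theorem totJump_eq_univ {f : Problem} (hf : ∀ p, p ∉ dom f) (x : Baire) :
    totJump f x = Set.univ := by
  rw [totJump, totJumpAt, if_neg]
  rintro ⟨r, -, hr, -⟩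
  exact hf r hr

theorem totalChoiceNat_of_mem {p : Baire} {n : ℕ} (h : n + 1 ∉ Set.range p) :
    totalChoiceNat p = choiceNat p := by
  rw [totalChoiceNat, totalization, if_pos]
  exact ⟨point n, h⟩

theorem dom_totalChoiceNat (p : Baire) : p ∈ dom totalChoiceNat := by
  by_cases h : p ∈ dom choiceNat
  · rw [dom, Set.mem_ofPred_eq, totalChoiceNat, totalization, if_pos h]; exact h
  · rw [dom, Set.mem_ofPred_eq, totalChoiceNat, totalization, if_neg h]; exact Set.univ_nonempty

theorem not_totalChoiceNat_reducible_totJump {f : Problem} (hf : ∀ p, p ∉ dom f) :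
    ¬ Reducible totalChoiceNat (totJump f) := by
  rintro ⟨e, i, h⟩
  have key : ∀ p, ∃ y ∈ functional₂ i p (point 0), y ∈ totalChoiceNat p := by
    intro p
    obtain ⟨r, -, -, hr⟩ := h p (dom_totalChoiceNat p)
    exact hr _ (by rw [totJump_eq_univ hf]; trivial)
  obtain ⟨y, hy, -⟩ := key fun _ => 0
  obtain ⟨s, hs⟩ := mem_functionalValue_iff.1 (mem_functional_iff.1 hy 0)
  -- Agrees with the zero sequence as far as `y 0` depends on it, then makes `y 0` wrong; `y 0 + 2`
  -- is never enumerated, so a wrong answer really counts.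
  let p : Baire := fun j => if j < s then 0 else y 0 + 1
  obtain ⟨y', hy', hsol⟩ := key p
  have hp : y 0 + 1 + 1 ∉ Set.range p := by
    rintro ⟨j, hj⟩
    simp only [p] at hj
    split_ifs at hj; omega
  rw [totalChoiceNat_of_mem hp] at hsol
  refine hsol ⟨s, ?_⟩
  have hval : y 0 ∈ functionalValue i (join p (point 0)) 0 := by
    refine mem_functionalValue_iff.2 ⟨s, ?_⟩
    rw [← hs, initSeg_congr (join_congr fun j hj => ?_)]
    simp [p, hj]
  simp [p, Part.mem_unique (mem_functional_iff.1 hy' 0) hval]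

/-! ### Problems with an instance -/

/-- The prefix of `⟨x, point n⟩` that is determined by the prefix `τ` of `x`. -/
def joinPoint (τ : List ℕ) (n : ℕ) : List ℕ :=
  (List.range (2 * τ.length)).map fun j =>
    if j % 2 = 0 then τ.getD (j / 2) 0 else if j / 2 = 0 then n else 0

theorem joinPoint_initSeg (x : Baire) (n s : ℕ) :
    joinPoint (initSeg x s) n = initSeg (join x (point n)) (2 * s) := by
  rw [joinPoint, length_initSeg]
  simp only [initSeg, List.map_inj_left, List.mem_range]
  intro j hj
  have hj' : j / 2 < s := by omega
  simp [List.getD_eq_getElem?_getD, hj', join, point]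

theorem primrec_joinPoint {α : Type*} [Primcodable α] {n : α → ℕ} {τ : α → List ℕ}
    (hτ : Primrec τ) (hn : Primrec n) : Primrec fun a => joinPoint (τ a) (n a) := by
  refine Primrec.list_map (Primrec.list_range.comp
    (Primrec.nat_mul.comp (Primrec.const 2) (Primrec.list_length.comp hτ))) ?_
  have hd : Primrec fun a : α × ℕ => a.2 / 2 := Primrec.nat_div.comp Primrec.snd (Primrec.const 2)
  exact Primrec.ite (Primrec.eq.comp (Primrec.nat_mod.comp Primrec.snd (Primrec.const 2))
      (Primrec.const 0))
    ((Primrec.list_getD 0).comp (hτ.comp Primrec.fst) hd)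
    (Primrec.ite (Primrec.eq.comp hd (Primrec.const 0)) (hn.comp Primrec.fst) (Primrec.const 0))

/-- Test for the value at `0` of a sequence that differs from one of the sequences `Φ_b(x, n)`. -/
def diagZero (b : ℕ) (τ : List ℕ) : Option ℕ :=
  firstHit (fun n => (approx b (joinPoint τ n) 0).map Nat.succ) τ.length

/-- Test for the value at `n + 1` of a sequence that differs from `Φ_b(x, n)` unless `n + 1` is in
the range of `Φ_a(x)`. -/
def diagSucc (a b : ℕ) (τ : List ℕ) (n : ℕ) : Option ℕ :=
  firstHit (fun j => if approx a τ j = some (n + 1) then some 0 else none) τ.length <|>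
    (approx b (joinPoint τ n) (n + 1)).map Nat.succ

/-- The tests for all values of the diagonal sequence. -/
def diag (a b : ℕ) (τ : List ℕ) (m : ℕ) : Option ℕ :=
  if m = 0 then diagZero b τ else diagSucc a b τ (m - 1)

theorem primrec_diag (a b : ℕ) : Primrec fun x : List ℕ × ℕ => diag a b x.1 x.2 := by
  have hpred : Primrec fun x : List ℕ × ℕ => x.2 - 1 :=
    Primrec.nat_sub.comp Primrec.snd (Primrec.const 1)
  have hlen : Primrec fun x : List ℕ × ℕ => x.1.length := Primrec.list_length.comp Primrec.fst
  have hfst : Primrec fun x : (List ℕ × ℕ) × ℕ => x.1.1 := Primrec.fst.comp Primrec.fst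
  refine Primrec.ite (Primrec.eq.comp Primrec.snd (Primrec.const 0)) ?_ ?_
  · refine primrec_firstHit ?_ hlen
    exact Primrec.option_map (primrec_approx (Primrec.const b)
      (primrec_joinPoint hfst Primrec.snd) (Primrec.const 0)) (Primrec.succ.comp Primrec.snd).to₂
  · refine Primrec.option_orElse.comp (primrec_firstHit ?_ hlen) ?_
    · exact Primrec.ite (Primrec.eq.comp (primrec_approx (Primrec.const a) hfst Primrec.snd)
        (Primrec.option_some.comp (Primrec.succ.comp (hpred.comp Primrec.fst))))
        (Primrec.const (some 0)) (Primrec.const none)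
    · exact Primrec.option_map (primrec_approx (Primrec.const b)
        (primrec_joinPoint Primrec.fst hpred) (Primrec.succ.comp hpred))
        (Primrec.succ.comp Primrec.snd).to₂

theorem exists_of_diag_zero {a b s v : ℕ} {x : Baire} (h : diag a b (initSeg x s) 0 = some v) :
    ∃ n, ∃ w ∈ functionalValue b (join x (point n)) 0, v = w + 1 := by
  obtain ⟨n, -, hn⟩ := exists_of_firstHit_eq_some h
  obtain ⟨w, hw, rfl⟩ := Option.map_eq_some_iff.1 hn
  rw [joinPoint_initSeg] at hw
  exact ⟨n, w, mem_functionalValue_iff.2 ⟨_, hw⟩, rfl⟩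

theorem exists_of_diag_succ {a b s n v : ℕ} {x : Baire}
    (h : diag a b (initSeg x s) (n + 1) = some v) :
    (∃ j, n + 1 ∈ functionalValue a x j) ∨
      ∃ w ∈ functionalValue b (join x (point n)) (n + 1), v = w + 1 := by
  simp only [diag, diagSucc, Nat.succ_ne_zero, if_false, Nat.add_sub_cancel,
    Option.orElse_eq_orElse, Option.orElse_eq_or, Option.or_eq_some_iff] at h
  rcases h with h | ⟨-, h⟩
  · obtain ⟨j, -, hj⟩ := exists_of_firstHit_eq_some h
    split_ifs at hj with hj'
    exact Or.inl ⟨j, mem_functionalValue_iff.2 ⟨_, hj'⟩⟩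
  · obtain ⟨w, hw, rfl⟩ := Option.map_eq_some_iff.1 h
    rw [joinPoint_initSeg] at hw
    exact Or.inr ⟨w, mem_functionalValue_iff.2 ⟨_, hw⟩, rfl⟩

theorem exists_approx_joinPoint {b n m : ℕ} {x : Baire}
    (h : (functionalValue b (join x (point n)) m).Dom) :
    ∃ s w, ∀ t ≥ s, approx b (joinPoint (initSeg x t) n) m = some w := by
  obtain ⟨w, hw⟩ := Part.dom_iff_mem.1 h
  obtain ⟨s, hs⟩ := mem_functionalValue_iff.1 hw
  refine ⟨s, w, fun t ht => ?_⟩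
  rw [joinPoint_initSeg]
  exact approx_mono (by omega) hs

theorem exists_diag_zero {a b n : ℕ} {x : Baire}
    (h : (functionalValue b (join x (point n)) 0).Dom) :
    ∃ s, ∀ t ≥ s, ∃ v, diag a b (initSeg x t) 0 = some v := by
  obtain ⟨s, w, hs⟩ := exists_approx_joinPoint h
  refine ⟨s + n + 1, fun t ht => ?_⟩
  have hn : n < (initSeg x t).length := by rw [length_initSeg]; omega
  refine exists_firstHit_eq_some (v := w + 1) hn ?_
  rw [hs t (by omega)]
  rfl

theorem exists_diag_succ_of_mem_range {a b n j : ℕ} {x : Baire}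
    (h : n + 1 ∈ functionalValue a x j) :
    ∃ s, ∀ t ≥ s, ∃ v, diag a b (initSeg x t) (n + 1) = some v := by
  obtain ⟨s, hs⟩ := mem_functionalValue_iff.1 h
  refine ⟨s + j + 1, fun t ht => ?_⟩
  have hj : j < (initSeg x t).length := by rw [length_initSeg]; omega
  obtain ⟨v, hv⟩ := exists_firstHit_eq_some
    (h := fun j => if approx a (initSeg x t) j = some (n + 1) then some 0 else none) hj
    (if_pos (approx_mono (by omega) hs))
  refine ⟨v, ?_⟩
  simp only [diag, diagSucc, Nat.succ_ne_zero, if_false, Nat.add_sub_cancel, hv]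
  rfl

theorem exists_diag_succ {a b n : ℕ} {x : Baire}
    (h : (functionalValue b (join x (point n)) (n + 1)).Dom) :
    ∃ s, ∀ t ≥ s, ∃ v, diag a b (initSeg x t) (n + 1) = some v := by
  obtain ⟨s, w, hs⟩ := exists_approx_joinPoint h
  refine ⟨s, fun t ht => ?_⟩
  simp only [diag, diagSucc, Nat.succ_ne_zero, if_false, Nat.add_sub_cancel, hs t ht]
  cases firstHit (fun j => if approx a (initSeg x t) j = some (n + 1) then some 0 else none)
    (initSeg x t).length with
  | none => exact ⟨w + 1, rfl⟩
  | some v => exact ⟨v, rfl⟩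

/-- The sequence `e, i, p(0), p(1), …`. -/
def triple (e i : ℕ) (p : Baire) : Baire
  | 0 => e
  | 1 => i
  | n + 2 => p n

theorem initSeg_triple (e i : ℕ) (p : Baire) (s : ℕ) :
    initSeg (triple e i p) (s + 2) = e :: i :: initSeg p s := by
  simp only [initSeg, List.range_succ_eq_map, List.map_cons, List.map_map]
  rfl

/-- The recursion theorem applied to `diag`: an index `i` of the functional whose value on `p` and
any `q` is given by the tests `diag` on the input `(e, i, p)`. -/
theorem exists_diag_index (e a b : ℕ) :
    ∃ i, ∀ p q m, functionalValue i (join p q) m =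
      Nat.rfindOpt fun s => diag a b (initSeg (triple e i p) ((s + 1) / 2 + 2)) m := by
  obtain ⟨i, hi⟩ := exists_index_join (T := fun i σ m => diag a b (e :: i :: σ) m)
    ((primrec_diag a b).comp <| Primrec.pair
      (Primrec.list_cons.comp (Primrec.const e) (Primrec.list_cons.comp Primrec.fst
        (Primrec.fst.comp Primrec.snd))) (Primrec.snd.comp Primrec.snd))
  exact ⟨i, fun p q m => by rw [hi]; simp only [initSeg_triple]⟩

theorem not_totJump_reducible_totalChoiceNat {f : Problem} {p : Baire} (hp : p ∈ dom f) :
    ¬ Reducible (totJump f) totalChoiceNat := by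
  rintro ⟨a, b, h⟩
  obtain ⟨e, he⟩ := exists_index_id
  obtain ⟨i, hi⟩ := exists_diag_index e a b
  set x := triple e i p with hx
  have hx' : totJump f x = totJumpAt f e i p := rfl
  -- `totJump f` is total, so the reduction applies to `x` before Φ_i is known to converge; this
  -- avoids circularity.
  have hdom : x ∈ dom (totJump f) := by
    rw [dom, Set.mem_ofPred_eq, hx', totJumpAt]
    split_ifs with hc
    · obtain ⟨r, hr, ⟨q, hq⟩, hd⟩ := hc
      exact ⟨_, r, hr, q, hq, Part.get_mem (hd q hq)⟩
    · exact Set.univ_nonempty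
  obtain ⟨r, hr, -, hsol⟩ := h x hdom
  rw [mem_functional_iff] at hr
  have hconv : ∀ n, point n ∈ totalChoiceNat r → ∃ y ∈ totJump f x,
      ∀ m, y m ∈ functionalValue b (join x (point n)) m := by
    intro n hn
    obtain ⟨y, hy, hy'⟩ := hsol _ hn
    exact ⟨y, hy', mem_functional_iff.1 hy⟩
  have hout : ∀ n, n + 1 ∉ Set.range r → point n ∈ totalChoiceNat r := by
    intro n hn
    rw [totalChoiceNat_of_mem hn]
    exact hn
  have hcase : (∀ n, point n ∈ totalChoiceNat r) ∨ ∃ n, n + 1 ∉ Set.range r := by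
    by_cases hn : ∃ n, n + 1 ∉ Set.range r
    · exact Or.inr hn
    · refine Or.inl fun n => ?_
      rw [totalChoiceNat, totalization, if_neg]
      · trivial
      · rintro ⟨q, hq⟩
        exact hn ⟨q 0, hq⟩
  have hsome : ∃ n, point n ∈ totalChoiceNat r :=
    hcase.elim (fun H => ⟨0, H 0⟩) fun ⟨n, hn⟩ => ⟨n, hout n hn⟩
  -- Each test succeeds: either `n + 1` appears in the range of `r`, or `n` is a correct answer and
  -- Φ_b converges on it.
  have hfound : ∀ m, ∃ s, ∀ t ≥ s, ∃ v, diag a b (initSeg x t) m = some v := by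
    rintro (_ | n)
    · obtain ⟨n, hn⟩ := hsome
      obtain ⟨y, -, hy⟩ := hconv n hn
      exact exists_diag_zero (Part.dom_iff_mem.2 ⟨_, hy 0⟩)
    · by_cases hn : n + 1 ∈ Set.range r
      · obtain ⟨j, hj⟩ := hn
        exact exists_diag_succ_of_mem_range (hj ▸ hr j)
      · obtain ⟨y, -, hy⟩ := hconv n (hout n hn)
        exact exists_diag_succ (Part.dom_iff_mem.2 ⟨_, hy (n + 1)⟩)
  have htotal : ∀ m, ∃ v s, diag a b (initSeg x s) m = some v ∧
      ∀ q, v ∈ functionalValue i (join p q) m := by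
    intro m
    have hd : (Nat.rfindOpt fun s => diag a b (initSeg x ((s + 1) / 2 + 2)) m).Dom := by
      obtain ⟨s, hs⟩ := hfound m
      -- Round `2 * s` of the search reads the prefix of `x` of length `s + 2`.
      obtain ⟨v, hv⟩ := hs ((2 * s + 1) / 2 + 2) (by omega)
      exact Nat.rfindOpt_dom.2 ⟨2 * s, v, hv⟩
    obtain ⟨v, hv⟩ := Part.dom_iff_mem.1 hd
    obtain ⟨s, hs⟩ := Nat.rfindOpt_spec hv
    exact ⟨v, _, hs, fun q => by rw [hi]; exact hv⟩
  choose z s hz hzi using htotal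
  have hzmem : ∀ q, z ∈ functional₂ i p q := fun q => mem_functional_iff.2 fun m => hzi m q
  have hjump : ∀ y ∈ totJump f x, y = z := by
    intro y hy
    rw [hx', totJumpAt, if_pos] at hy
    · obtain ⟨r', hr', q, -, hyq⟩ := hy
      rw [he, Part.mem_some_iff] at hr'
      exact Part.mem_unique hyq (hzmem q)
    · exact ⟨p, by rw [he]; exact Part.mem_some p, hp,
        fun q _ => Part.dom_iff_mem.2 ⟨z, hzmem q⟩⟩
  have hzconv : ∀ n, point n ∈ totalChoiceNat r →
      ∀ m, z m ∈ functionalValue b (join x (point n)) m := by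
    intro n hn
    obtain ⟨y, hy, hyb⟩ := hconv n hn
    exact hjump y hy ▸ hyb
  rcases hcase with hall | ⟨n, hn⟩
  · obtain ⟨n, w, hw, hv⟩ := exists_of_diag_zero (hz 0)
    have := Part.mem_unique hw (hzconv n (hall n) 0)
    omega
  · rcases exists_of_diag_succ (hz (n + 1)) with ⟨j, hj⟩ | ⟨w, hw, hv⟩
    · exact hn ⟨j, Part.mem_unique (hr j) hj⟩
    · have := Part.mem_unique hw (hzconv n (hout n hn) (n + 1))
      omega

end Weihrauch

theorem mainTheorem11 :
    ¬ ∃ f : Weihrauch.Problem,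
      Weihrauch.Equivalent Weihrauch.totalChoiceNat (Weihrauch.totJump f) := by
  rintro ⟨f, h₁, h₂⟩
  by_cases hf : ∃ p, p ∈ Weihrauch.dom f
  · obtain ⟨p, hp⟩ := hf
    exact Weihrauch.not_totJump_reducible_totalChoiceNat hp h₂
  · exact Weihrauch.not_totalChoiceNat_reducible_totJump (not_exists.1 hf) h₁
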